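/- **Theorem (Monopolist Game).** *The game.* There are $k$ players with equal initial capital $I/k$, where $I>0$ is real. In every round each player wins with probability $1/k$, independently of the other rounds; the winner receives $k-1$ units and each of the other players loses one unit. An outcome of $n$ rounds is the word $x\in\{1,\dots,k\}^n$ of the successive winners, all $k^n$ words being equally likely. If player $i$ wins $m_i$ of the first $m$ rounds, its capital after $m$ rounds is $I/k+(k-1)m_i-(m-m_i)$ (positive or negative). A player has lost all of its money by round $m$ if its capital was $\le 0$ after some round $m'\le m$. A player is a monopolist at round $m$ if its capital after round $m$ is positive and every other player has lost all of its money by round $m$. *Complexity.* $\log$ is the logarithm to base $2$, and $l(i)$ is the length of the $i$-th binary string in the length-increasing lexicographical order (strings and natural numbers are identified in this way). With $E_0(z)=1^z0$ and $E_{j+1}(z)=E_j(l(z))\,z$, the reference machine $U$, given a program $E_2(i)\,p$ and side information $y$, runs the $i$-th partial recursive function $T_i$ (of the standard numbering in which $T_0$ is the constant $0$) on $\langle p,y\rangle$. $C(x\mid y)$ is the length of a shortest program with which $U$ computes $x$ from $y$; outcomes and pairs are coded by natural numbers in a standard way. (i) For every $k\ge 2$ there is a constant $\delta>0$ such that for every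 $\varepsilon>0$ and all sufficiently large $n$ (depending on $k$ and $\varepsilon$) the following holds with $\delta(k,n)=\delta n^{2\varepsilon}\log k$. If an outcome $x$ of $n$ rounds satisfies $C(x\mid k,n)\ge n\log k-\delta(k,n)$, then for every $I>0$ with $n<I^{2/(1+2\varepsilon)}$ there is no monopolist at any round $m\le n$. The inequality $C(x\mid k,n)\ge n\log k-\delta(k,n)$ holds with probability at least $1-1/2^{\delta(k,n)}$; hence, for each such $I$, with at least this probability there is no monopolist at any round $m\le n$. (ii) For every $k\ge 3$, every $0<\varepsilon<\frac14$ and all sufficiently large $n$ (depending on $k$ and $\varepsilon$) the following holds. If an outcome $x$ of $n$ rounds satisfies $C(x\mid n,k)\ge n\log k-\varepsilon\log n$, then for every $I>0$ with $n=\lfloor (I/(k-2))^{2/(1-2\varepsilon)}\rfloor$ there is a monopolist at some round $m\le (I/(k-2))^{2/(1-2\varepsilon)}$. The inequality $C(x\mid n,k)\ge n\log k-\varepsilon\log n$ holds with probability at least $1-1/n^{\varepsilon}$; hence, for each such $I$, with at least this probability there is a monopolist at some round $m\le (I/(k-2))^{2/(1-2\varepsilon)}$. -/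

import Mathlib

namespace MonopolistGame

/-! Strings, numbers and self-delimiting codes. -/

/-- The binary string with index `n` in the length-increasing lexicographical ordering
`0 ↦ []`, `1 ↦ 0`, `2 ↦ 1`, `3 ↦ 00`, `4 ↦ 01`, ... : the binary expansion of `n + 1`
without its leading `1`. -/
def toStr (n : ℕ) : List Bool := (Nat.bits (n + 1)).dropLast.reverse

/-- The length `l(n)` of the string with index `n`. -/
def len (n : ℕ) : ℕ := (toStr n).length

/-- The self-delimiting codes `E_0(x) = 1^x 0` and `E_{i+1}(x) = E_i(l(x)) x`. -/
def selfDelim : ℕ → ℕ → List Bool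
  | 0, x => List.replicate x true ++ [false]
  | i + 1, x => selfDelim i (len x) ++ toStr x

/-- The reference universal machine `U`, as the relation "`U` on program `q` and side
information `y` halts with output `x`". The programs are the strings `⟨i, p⟩ = E_2(i) p`; on such
a program `U` runs the `i`-th partial recursive function on the pair `(p, y)`. -/
def Outputs (q : List Bool) (y x : ℕ) : Prop :=
  ∃ i p : ℕ, q = selfDelim 2 i ++ toStr p ∧
    x ∈ (Denumerable.ofNat Nat.Partrec.Code i).eval (Nat.pair p y)

/-- The conditional Kolmogorov complexity `C(x | y)`: the length of a shortest program from which
`U` computes `x` when given `y`. -/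
noncomputable def condComplexity (x y : ℕ) : ℕ :=
  sInf {l : ℕ | ∃ q : List Bool, q.length = l ∧ Outputs q y x}

/-- Every `x` has a program, so the minimum in the definition of `C(x | y)` is attained. -/
theorem exists_program (x y : ℕ) :
    ∃ q : List Bool, q.length = condComplexity x y ∧ Outputs q y x := by
  have h : {l : ℕ | ∃ q : List Bool, q.length = l ∧ Outputs q y x}.Nonempty :=
    ⟨_, _, rfl, Encodable.encode (Nat.Partrec.Code.const x), 0, rfl, by simp⟩
  exact Nat.sInf_mem h

/-- The number that codes an outcome (the list of the winners of the successive rounds). -/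
def code {k n : ℕ} (x : Fin n → Fin k) : ℕ :=
  Encodable.encode (List.ofFn fun t => (x t : ℕ))

/-! The game. An outcome of `n` rounds with `k` players is `x : Fin n → Fin k`, where `x t` is the
winner of round `t + 1`. -/

/-- The number of rounds among the first `m` that player `i` wins. -/
def wins {k n : ℕ} (x : Fin n → Fin k) (m : ℕ) (i : Fin k) : ℕ :=
  (Finset.univ.filter fun t : Fin n => (t : ℕ) < m ∧ x t = i).card

/-- The capital (positive or negative) of player `i` after `m ≤ n` rounds: every player starts with
`I / k`, gains `k - 1` units in each round it wins and loses one unit in every other round. -/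
noncomputable def capital {k n : ℕ} (I : ℝ) (x : Fin n → Fin k) (m : ℕ) (i : Fin k) : ℝ :=
  I / k + ((k : ℝ) - 1) * wins x m i - ((m : ℝ) - wins x m i)

/-- Player `j` has lost all of its money by round `m`. -/
def HasLostAll {k n : ℕ} (I : ℝ) (x : Fin n → Fin k) (m : ℕ) (j : Fin k) : Prop :=
  ∃ m' ≤ m, capital I x m' j ≤ 0

/-- Player `i` is a monopolist at round `m`: it has money, and all the other players have lost all
of theirs. -/
def IsMonopolist {k n : ℕ} (I : ℝ) (x : Fin n → Fin k) (m : ℕ) (i : Fin k) : Prop :=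
  0 < capital I x m i ∧ ∀ j, j ≠ i → HasLostAll I x m j

/-- The probability of a set of outcomes of `n` rounds: in every round each of the `k` players wins
with probability `1 / k`, independently, so all `k ^ n` outcomes are equally likely. -/
noncomputable def prob {k n : ℕ} (S : Set (Fin n → Fin k)) : ℝ :=
  (S.ncard : ℝ) / (k : ℝ) ^ n

end MonopolistGame

namespace MonopolistGame

/-! ### Strings and self-delimiting codes -/

theorem dropLast_bits_append (n : ℕ) : (Nat.bits (n + 1)).dropLast ++ [true] = Nat.bits (n + 1) := by
  have key : ∀ m : ℕ, m ≠ 0 → (Nat.bits m).dropLast ++ [true] = Nat.bits m := by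
    intro m
    induction m using Nat.binaryRec' with
    | zero => intro h; exact absurd rfl h
    | bit b m hb ih =>
      intro _
      rw [Nat.bits_append_bit m b hb]
      by_cases hm : m = 0
      · subst hm
        simp [hb rfl]
      · have hne : Nat.bits m ≠ [] := by
          intro h
          have := ih hm
          rw [h] at this
          simp at this
        rw [List.dropLast_cons_of_ne_nil hne, List.cons_append, ih hm]
  exact key _ n.succ_ne_zero

theorem toStr_injective : Function.Injective toStr := by
  intro a b h
  have h1 : (Nat.bits (a + 1)).dropLast = (Nat.bits (b + 1)).dropLast :=
    List.reverse_injective h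
  have h2 : Nat.bits (a + 1) = Nat.bits (b + 1) := by
    rw [← dropLast_bits_append a, ← dropLast_bits_append b, h1]
  have h3 : a + 1 = b + 1 := by
    rw [← Nat.ofDigits_digits 2 (a + 1), ← Nat.ofDigits_digits 2 (b + 1),
      Nat.digits_two_eq_bits, Nat.digits_two_eq_bits, h2]
  omega

theorem len_eq_log (n : ℕ) : len n = Nat.log 2 (n + 1) := by
  have h : (Nat.bits (n + 1)).length = Nat.log 2 (n + 1) + 1 := by
    have := congrArg List.length (Nat.digits_two_eq_bits (n + 1))
    rw [List.length_map] at this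
    rw [← this, Nat.length_digits 2 _ (by norm_num) (by omega)]
  simp [len, toStr, h]

theorem selfDelim_append_inj (j : ℕ) :
    ∀ {a b : ℕ} {u v : List Bool}, selfDelim j a ++ u = selfDelim j b ++ v → a = b ∧ u = v := by
  induction j with
  | zero =>
    intro a
    induction a with
    | zero =>
      intro b u v h
      cases b with
      | zero => exact ⟨rfl, by simpa [selfDelim] using h⟩
      | succ b => simp [selfDelim, List.replicate_succ] at h
    | succ a ih =>
      intro b u v h
      cases b with
      | zero => simp [selfDelim, List.replicate_succ] at h
      | succ b =>
        have h' : selfDelim 0 a ++ u = selfDelim 0 b ++ v := by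
          simpa [selfDelim, List.replicate_succ] using h
        exact ⟨congrArg (· + 1) (ih h').1, (ih h').2⟩
  | succ j ih =>
    intro a b u v h
    simp only [selfDelim, List.append_assoc] at h
    obtain ⟨h1, h2⟩ := ih h
    obtain ⟨h3, h4⟩ := List.append_inj h2 h1
    exact ⟨toStr_injective h3, h4⟩

theorem selfDelim_head (j : ℕ) : ∀ a : ℕ, a ≠ 0 → ∃ u, selfDelim j a = true :: u := by
  induction j with
  | zero =>
    intro a ha
    obtain ⟨b, rfl⟩ := Nat.exists_eq_succ_of_ne_zero ha
    exact ⟨_, by simp [selfDelim, List.replicate_succ]; rfl⟩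
  | succ j ih =>
    intro a ha
    have hl : len a ≠ 0 := by
      rw [len_eq_log]
      have : 0 < Nat.log 2 (a + 1) := Nat.log_pos (by norm_num) (by omega)
      omega
    obtain ⟨u, hu⟩ := ih _ hl
    exact ⟨u ++ toStr a, by simp [selfDelim, hu]⟩

theorem Outputs.unique {q : List Bool} {y x x' : ℕ} (h : Outputs q y x) (h' : Outputs q y x') :
    x = x' := by
  obtain ⟨i, p, hq, hx⟩ := h
  obtain ⟨i', p', hq', hx'⟩ := h'
  obtain ⟨hi, hp⟩ := selfDelim_append_inj 2 (hq.symm.trans hq')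
  have hp := toStr_injective hp
  subst hi hp
  exact Part.mem_unique hx hx'

/-- A program whose output is not `0` starts with the bit `1`, since `T_0` is the constant `0`. -/
theorem Outputs.head {q : List Bool} {y x : ℕ} (h : Outputs q y x) (hx0 : x ≠ 0) :
    ∃ u, q = true :: u := by
  obtain ⟨i, p, hq, hx⟩ := h
  by_cases hi : i = 0
  · subst hi
    have h0 : Denumerable.ofNat Nat.Partrec.Code 0 = Nat.Partrec.Code.zero := by
      rw [Nat.Partrec.Code.ofNatCode_eq]
      simp [Nat.Partrec.Code.ofNatCode]
    rw [h0] at hx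
    simp [Nat.Partrec.Code.eval, pure, PFun.pure] at hx
    exact absurd hx hx0
  · obtain ⟨u, hu⟩ := selfDelim_head 2 i hi
    exact ⟨u ++ toStr p, by simp [hq, hu]⟩

theorem code_injective {k n : ℕ} : Function.Injective (code : (Fin n → Fin k) → ℕ) := by
  intro x x' h
  have h1 := List.ofFn_injective (Encodable.encode_injective h)
  funext t
  exact Fin.ext (congrFun h1 t)

theorem code_ne_zero {k n : ℕ} (hn : n ≠ 0) (x : Fin n → Fin k) : code x ≠ 0 := by
  obtain ⟨m, rfl⟩ := Nat.exists_eq_succ_of_ne_zero hn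
  simp [code, List.ofFn_succ]

/-! ### There are few outcomes of small complexity -/

theorem ncard_length_lt (t : ℕ) :
    {q : List Bool | q.length < t}.Finite ∧ {q : List Bool | q.length < t}.ncard ≤ 2 ^ t := by
  have hfin : {q : List Bool | q.length < t}.Finite := List.finite_length_lt Bool t
  refine ⟨hfin, ?_⟩
  have h : {q : List Bool | q.length < t} ⊆
      ((Finset.range t).biUnion fun l =>
        (Finset.univ : Finset (List.Vector Bool l)).image List.Vector.toList : Finset (List Bool)) := by
    intro q hq
    simp only [Finset.coe_biUnion, Set.mem_iUnion]
    exact ⟨q.length, by simpa using hq, by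
      simp only [Finset.coe_image, Finset.coe_univ, Set.image_univ]
      exact ⟨⟨q, rfl⟩, rfl⟩⟩
  calc {q : List Bool | q.length < t}.ncard
      ≤ _ := Set.ncard_le_ncard h (Finset.finite_toSet _)
    _ = _ := Set.ncard_coe_finset _
    _ ≤ ∑ l ∈ Finset.range t, _ := Finset.card_biUnion_le
    _ ≤ ∑ l ∈ Finset.range t, 2 ^ l := by
        refine Finset.sum_le_sum fun l _ => Finset.card_image_le.trans ?_
        rw [Finset.card_univ, card_vector, Fintype.card_bool]
    _ ≤ 2 ^ t := by
        rw [Nat.geomSum_eq (le_refl 2)]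
        simp

theorem ncard_condComplexity_lt {k n : ℕ} (hn : n ≠ 0) (y : ℕ) (L : ℝ) :
    ({x : Fin n → Fin k | (condComplexity (code x) y : ℝ) < L}.ncard : ℝ) ≤ (2 : ℝ) ^ L := by
  rcases le_or_gt L 0 with hL | hL
  · have : {x : Fin n → Fin k | (condComplexity (code x) y : ℝ) < L} = ∅ := by
      ext x
      simp only [Set.mem_ofPred_eq, Set.mem_empty_iff_false, iff_false, not_lt]
      exact hL.trans (Nat.cast_nonneg _)
    rw [this]
    simp only [Set.ncard_empty, Nat.cast_zero]
    positivity
  · choose q hq using fun x : Fin n → Fin k => exists_program (code x) y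
    choose u hu using fun x => (hq x).2.head (code_ne_zero hn x)
    have hinj : Function.Injective u := by
      intro x x' h
      refine code_injective ((hq x).2.unique ?_)
      rw [hu x, h, ← hu x']
      exact (hq x').2
    have hceil : 0 < ⌈L⌉₊ := Nat.ceil_pos.2 hL
    obtain ⟨hfin, hcard⟩ := ncard_length_lt (⌈L⌉₊ - 1)
    have h1 : {x : Fin n → Fin k | (condComplexity (code x) y : ℝ) < L}.ncard ≤
        2 ^ (⌈L⌉₊ - 1) := by
      refine le_trans ?_ hcard
      refine Set.ncard_le_ncard_of_injOn u ?_ hinj.injOn hfin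
      intro x hx
      have h2 : (u x).length + 1 = condComplexity (code x) y := by
        rw [← (hq x).1, hu x, List.length_cons]
      have h3 : condComplexity (code x) y < ⌈L⌉₊ := Nat.lt_ceil.2 hx
      simp only [Set.mem_ofPred_eq]
      omega
    calc ({x : Fin n → Fin k | (condComplexity (code x) y : ℝ) < L}.ncard : ℝ)
        ≤ ((2 ^ (⌈L⌉₊ - 1) : ℕ) : ℝ) := by exact_mod_cast h1
      _ = (2 : ℝ) ^ ((⌈L⌉₊ - 1 : ℕ) : ℝ) := by push_cast; rw [Real.rpow_natCast]
      _ ≤ (2 : ℝ) ^ L := by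
          refine Real.rpow_le_rpow_of_exponent_le (by norm_num) ?_
          rw [Nat.cast_sub hceil]
          have := Nat.ceil_lt_add_one hL.le
          push_cast
          linarith

theorem prob_mono {k n : ℕ} {S T : Set (Fin n → Fin k)} (h : S ⊆ T) : prob S ≤ prob T := by
  unfold prob
  gcongr
  exact Set.toFinite T

/-- Incompressibility with deficiency `d` has probability at least `1 - 2 ^ (-d)`. -/
theorem one_sub_le_prob_condComplexity {k n : ℕ} (hk : k ≠ 0) (hn : n ≠ 0) (y : ℕ) (d : ℝ) :
    1 - 1 / (2 : ℝ) ^ d ≤ prob {x : Fin n → Fin k |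
      (n : ℝ) * Real.logb 2 k - d ≤ (condComplexity (code x) y : ℝ)} := by
  set A := {x : Fin n → Fin k | (n : ℝ) * Real.logb 2 k - d ≤ (condComplexity (code x) y : ℝ)}
  have hkpos : (0 : ℝ) < k := by positivity
  have hpow : (2 : ℝ) ^ ((n : ℝ) * Real.logb 2 k - d) = (k : ℝ) ^ n / (2 : ℝ) ^ d := by
    rw [Real.rpow_sub (by norm_num), mul_comm, Real.rpow_mul (by norm_num),
      Real.rpow_logb (by norm_num) (by norm_num) hkpos, Real.rpow_natCast]
  have hcompl : (Aᶜ.ncard : ℝ) ≤ (k : ℝ) ^ n / (2 : ℝ) ^ d := by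
    rw [← hpow]
    refine le_trans (le_of_eq ?_)
      (ncard_condComplexity_lt (k := k) hn y ((n : ℝ) * Real.logb 2 k - d))
    congr 2
    ext x
    simp only [A, Set.mem_compl_iff, Set.mem_ofPred_eq, not_le]
  have hsum : (A.ncard : ℝ) + (Aᶜ.ncard : ℝ) = (k : ℝ) ^ n := by
    have := Set.ncard_add_ncard_compl A
    rw [Nat.card_eq_fintype_card, Fintype.card_fun, Fintype.card_fin, Fintype.card_fin] at this
    exact_mod_cast this
  unfold prob
  rw [le_div_iff₀ (by positivity)]
  have : (1 - 1 / (2 : ℝ) ^ d) * (k : ℝ) ^ n = (k : ℝ) ^ n - (k : ℝ) ^ n / (2 : ℝ) ^ d := by ring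
  rw [this]
  linarith

theorem primrec_pow : Primrec₂ ((· ^ ·) : ℕ → ℕ → ℕ) :=
  Primrec₂.unpaired'.1 Nat.Primrec.pow

/-! ### Description by an index in a decidable set -/

theorem primrec_count {r : ℕ → ℕ → ℕ → Bool}
    (hr : Primrec fun t : (ℕ × ℕ) × ℕ => r t.1.1 t.1.2 t.2) :
    Primrec fun t : (ℕ × ℕ) × ℕ => Nat.count (fun z => r t.1.1 t.1.2 z = true) t.2 := by
  have h : Primrec fun t : (ℕ × ℕ) × ℕ =>
      (Nat.rec 0 (fun z c => if r t.1.1 t.1.2 z = true then c + 1 else c) t.2 : ℕ) := by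
    refine Primrec.nat_rec' (f := fun t : (ℕ × ℕ) × ℕ => t.2) (g := fun _ => 0)
      (h := fun t p => if r t.1.1 t.1.2 p.1 = true then p.2 + 1 else p.2)
      Primrec.snd (Primrec.const 0) ?_
    have h1 : Primrec fun a : ((ℕ × ℕ) × ℕ) × (ℕ × ℕ) => r a.1.1.1 a.1.1.2 a.2.1 :=
      hr.comp ((Primrec.fst.comp Primrec.fst).pair (Primrec.fst.comp Primrec.snd))
    have h2 : Primrec fun a : ((ℕ × ℕ) × ℕ) × (ℕ × ℕ) => a.2.2 :=
      Primrec.snd.comp Primrec.snd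
    exact Primrec.ite (Primrec.eq.comp h1 (Primrec.const true)) (Primrec.succ.comp h2) h2
  refine h.of_eq fun t => ?_
  induction t.2 with
  | zero => simp
  | succ z ih =>
    simp only [Nat.count_succ, ← ih]
    split_ifs <;> rfl

theorem two_pow_mul_odd_inj {s s' a a' : ℕ}
    (h : 2 ^ s * (2 * a + 1) = 2 ^ s' * (2 * a' + 1)) : s = s' ∧ a = a' := by
  wlog hs : s ≤ s' generalizing s s' a a'
  · obtain ⟨h1, h2⟩ := this h.symm (by omega)
    exact ⟨h1.symm, h2.symm⟩
  obtain ⟨d, rfl⟩ := Nat.exists_eq_add_of_le hs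
  rw [pow_add, mul_assoc] at h
  have h1 := Nat.eq_of_mul_eq_mul_left (by positivity) h
  cases d with
  | zero => exact ⟨rfl, by simpa using h1⟩
  | succ d =>
    rw [pow_succ', mul_assoc] at h1
    omega

/-- There is a machine that, given `y`, finds `x` from the number `2 ^ s * (2 * a + 1)` when `x` is
the element number `a` of the set `{x | r s y x}`. -/
theorem exists_machine {r : ℕ → ℕ → ℕ → Bool}
    (hr : Primrec fun t : (ℕ × ℕ) × ℕ => r t.1.1 t.1.2 t.2) :
    ∃ i : ℕ, ∀ s y x : ℕ, r s y x = true →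
      x ∈ (Denumerable.ofNat Nat.Partrec.Code i).eval
        (Nat.pair (2 ^ s * (2 * Nat.count (fun z => r s y z = true) x + 1)) y) := by
  let test : ℕ → ℕ → Bool := fun q c => decide (r c.unpair.1 q.unpair.2 c.unpair.2 = true ∧
    2 ^ c.unpair.1 * (2 * Nat.count (fun z => r c.unpair.1 q.unpair.2 z = true) c.unpair.2 + 1)
      = q.unpair.1)
  have htest : Primrec₂ test := by
    have hs : Primrec fun a : ℕ × ℕ => a.2.unpair.1 :=
      Primrec.fst.comp (Primrec.unpair.comp Primrec.snd)
    have hx : Primrec fun a : ℕ × ℕ => a.2.unpair.2 :=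
      Primrec.snd.comp (Primrec.unpair.comp Primrec.snd)
    have hp : Primrec fun a : ℕ × ℕ => a.1.unpair.1 :=
      Primrec.fst.comp (Primrec.unpair.comp Primrec.fst)
    have hy : Primrec fun a : ℕ × ℕ => a.1.unpair.2 :=
      Primrec.snd.comp (Primrec.unpair.comp Primrec.fst)
    have harg : Primrec fun a : ℕ × ℕ => ((a.2.unpair.1, a.1.unpair.2), a.2.unpair.2) :=
      (hs.pair hy).pair hx
    have hpow : Primrec fun a : ℕ × ℕ => 2 ^ a.2.unpair.1 :=
      primrec_pow.comp (Primrec.const 2) hs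
    have hodd := Primrec.succ.comp
      (Primrec.nat_mul.comp (Primrec.const 2) ((primrec_count hr).comp harg))
    exact PrimrecPred.decide (PrimrecPred.and
      (Primrec.eq.comp (hr.comp harg) (Primrec.const true))
      (Primrec.eq.comp (Primrec.nat_mul.comp hpow hodd) hp))
  have hf : Partrec fun q : ℕ =>
      (Nat.rfind fun c => Part.some (test q c)).map fun c => c.unpair.2 := by
    refine Partrec.map (Partrec.rfind htest.to_comp.partrec₂) ?_
    exact (Primrec.snd.comp (Primrec.unpair.comp Primrec.snd)).to_comp
  obtain ⟨c, hc⟩ := Nat.Partrec.Code.exists_code.1 (Partrec.nat_iff.1 hf)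
  refine ⟨Encodable.encode c, fun s y x hx => ?_⟩
  rw [Denumerable.ofNat_encode, hc]
  set q := Nat.pair (2 ^ s * (2 * Nat.count (fun z => r s y z = true) x + 1)) y with hq
  have hspec : ∀ c, test q c = true ↔ c = Nat.pair s x := by
    intro c
    simp only [test, decide_eq_true_eq, hq, Nat.unpair_pair]
    constructor
    · rintro ⟨h1, h2⟩
      obtain ⟨h3, h4⟩ := two_pow_mul_odd_inj h2
      rw [h3] at h1 h4
      rw [← Nat.pair_unpair c, h3, Nat.count_injective h1 hx h4]
    · rintro rfl
      simp [hx]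
  have hmem : Nat.pair s x ∈ Nat.rfind fun c => Part.some (test q c) := by
    refine Nat.mem_rfind.2 ⟨by simp [(hspec _).2 rfl], fun {m} hm => ?_⟩
    have : test q m = false := by
      rw [← Bool.not_eq_true, hspec]
      exact hm.ne
    simp [this]
  exact Part.mem_map_iff _ |>.2 ⟨_, hmem, by simp⟩

theorem condComplexity_le_log_ncard {r : ℕ → ℕ → ℕ → Bool}
    (hr : Primrec fun t : (ℕ × ℕ) × ℕ => r t.1.1 t.1.2 t.2) :
    ∃ c : ℕ, ∀ s y x : ℕ, r s y x = true → {z | r s y z = true}.Finite →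
      condComplexity x y ≤ c + s + Nat.log 2 {z | r s y z = true}.ncard := by
  obtain ⟨i, hi⟩ := exists_machine hr
  refine ⟨(selfDelim 2 i).length + 1, fun s y x hx hfin => ?_⟩
  set a := Nat.count (fun z => r s y z = true) x with ha
  set M := {z | r s y z = true}.ncard with hM
  have haM : a + 1 ≤ M := by
    have h1 : a + 1 = Nat.count (fun z => r s y z = true) (x + 1) := by
      rw [Nat.count_succ, if_pos hx]
    rw [h1, Nat.count_eq_card_filter_range, ← Set.ncard_coe_finset]
    refine Set.ncard_le_ncard ?_ hfin
    intro z hz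
    simpa using (Finset.mem_filter.1 (Finset.mem_coe.1 hz)).2
  have h1 : condComplexity x y ≤
      (selfDelim 2 i ++ toStr (2 ^ s * (2 * a + 1))).length :=
    Nat.sInf_le ⟨_, rfl, i, _, rfl, hi s y x hx⟩
  rw [List.length_append] at h1
  have h2 : (toStr (2 ^ s * (2 * a + 1))).length ≤ s + 1 + Nat.log 2 M := by
    change len _ ≤ _
    rw [len_eq_log]
    have hM0 : M ≠ 0 := by omega
    have h3 : 2 ^ s * (2 * a + 1) + 1 ≤ M * 2 ^ (s + 1) := by
      have : 1 ≤ 2 ^ s := Nat.one_le_two_pow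
      calc 2 ^ s * (2 * a + 1) + 1 ≤ 2 ^ s * (2 * a + 1) + 2 ^ s := by omega
        _ = (a + 1) * 2 ^ (s + 1) := by ring
        _ ≤ M * 2 ^ (s + 1) := Nat.mul_le_mul_right _ haM
    refine (Nat.log_mono_right h3).trans (le_of_eq ?_)
    have hlog : ∀ e : ℕ, Nat.log 2 (M * 2 ^ e) = Nat.log 2 M + e := by
      intro e
      induction e with
      | zero => simp
      | succ e ih =>
        rw [pow_succ, ← mul_assoc, Nat.log_mul_base (by norm_num) (by positivity), ih]
        ring
    rw [hlog]
    ring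
  omega

/-- The list of the winners of the successive rounds. -/
def winners {k n : ℕ} (x : Fin n → Fin k) : List ℕ := List.ofFn fun t => (x t : ℕ)

theorem exists_winners_eq {k n : ℕ} {l : List ℕ} (hl : l.length = n) (hk : ∀ a ∈ l, a < k) :
    ∃ x : Fin n → Fin k, winners x = l := by
  subst hl
  exact ⟨fun t => ⟨l.get t, hk _ (List.get_mem l t)⟩, List.ofFn_get l⟩

/-- An outcome in a primitive recursive set of outcomes of `n` rounds is described by its index. -/
theorem condComplexity_code_le (k : ℕ) {ν : ℕ → ℕ} (hν : Primrec ν) {G : ℕ → ℕ → List ℕ → Prop}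
    (hG : PrimrecPred fun t : (ℕ × ℕ) × List ℕ => G t.1.1 t.1.2 t.2) :
    ∃ c : ℕ, ∀ s y n : ℕ, ν y = n → ∀ x : Fin n → Fin k, G s y (winners x) →
      (condComplexity (code x) y : ℝ) ≤
        c + s + Real.logb 2 ({x : Fin n → Fin k | G s y (winners x)}.ncard : ℝ) := by
  classical
  let r : ℕ → ℕ → ℕ → Bool := fun s y z => (Encodable.decode₂ (List ℕ) z).casesOn false
    fun l => decide ((l.length = ν y ∧ ∀ a ∈ l, a < k) ∧ G s y l)
  have hr : Primrec fun t : (ℕ × ℕ) × ℕ => r t.1.1 t.1.2 t.2 := by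
    refine Primrec.option_casesOn (o := fun t : (ℕ × ℕ) × ℕ => Encodable.decode₂ (List ℕ) t.2)
      (Primrec.decode₂.comp Primrec.snd) (Primrec.const false)
      (g := fun t l => decide ((l.length = ν t.1.2 ∧ ∀ a ∈ l, a < k) ∧ G t.1.1 t.1.2 l)) ?_
    have hlen : PrimrecPred fun a : ((ℕ × ℕ) × ℕ) × List ℕ => a.2.length = ν a.1.1.2 :=
      Primrec.eq.comp (Primrec.list_length.comp Primrec.snd)
        (hν.comp (Primrec.snd.comp (Primrec.fst.comp Primrec.fst)))
    have hall : PrimrecPred fun a : ((ℕ × ℕ) × ℕ) × List ℕ => ∀ b ∈ a.2, b < k :=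
      (PrimrecPred.forall_mem_list
        (Primrec.nat_lt.comp Primrec.id (Primrec.const k))).comp Primrec.snd
    have hG' : PrimrecPred fun a : ((ℕ × ℕ) × ℕ) × List ℕ => G a.1.1.1 a.1.1.2 a.2 :=
      hG.comp ((Primrec.fst.comp Primrec.fst).pair Primrec.snd)
    exact PrimrecPred.decide ((hlen.and hall).and hG')
  obtain ⟨c, hc⟩ := condComplexity_le_log_ncard hr
  refine ⟨c, fun s y n hn x hx => ?_⟩
  set A := {x : Fin n → Fin k | G s y (winners x)} with hA
  have hset : {z | r s y z = true} = code '' A := by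
    ext z
    simp only [Set.mem_ofPred_eq, Set.mem_image]
    constructor
    · intro hz
      cases hd : Encodable.decode₂ (List ℕ) z with
      | none => simp [r, hd] at hz
      | some l =>
        simp only [r, hd, decide_eq_true_eq, hn] at hz
        obtain ⟨x', hx'⟩ := exists_winners_eq hz.1.1 hz.1.2
        refine ⟨x', ?_, ?_⟩
        · rw [hA, Set.mem_ofPred_eq, hx']
          exact hz.2
        · change Encodable.encode (winners x') = z
          rw [hx']
          exact Encodable.mem_decode₂.1 hd
    · rintro ⟨x', hx', rfl⟩
      have hd : Encodable.decode₂ (List ℕ) (code x') = some (winners x') :=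
        Encodable.mem_decode₂.2 rfl
      simp only [r, hd, decide_eq_true_eq, hn]
      refine ⟨⟨by simp [winners], ?_⟩, hx'⟩
      intro a ha
      obtain ⟨t, rfl⟩ := (List.mem_ofFn' _ _).1 ha
      exact (x' t).isLt
  have hfin : {z | r s y z = true}.Finite := by
    rw [hset]
    exact (Set.toFinite A).image _
  have hcard : {z | r s y z = true}.ncard = A.ncard := by
    rw [hset]
    exact Set.ncard_image_of_injective _ code_injective
  have hmem : r s y (code x) = true := by
    have : code x ∈ {z | r s y z = true} := by
      rw [hset]
      exact ⟨x, hx, rfl⟩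
    exact this
  have h := hc s y (code x) hmem hfin
  rw [hcard] at h
  calc (condComplexity (code x) y : ℝ) ≤ ((c + s + Nat.log 2 A.ncard : ℕ) : ℝ) := by
        exact_mod_cast h
    _ ≤ _ := by
        push_cast
        gcongr
        have := Real.natLog_le_logb A.ncard 2
        exact_mod_cast this

/-! ### Ruin -/

/-- The remaining capital of player `j` after the rounds with winners `l`, in units, when the player
starts with `T` and has to stop when nothing is left. -/
def purse (k j T : ℕ) (l : List ℕ) : ℕ :=
  l.foldl (fun c a => if c = 0 then 0 else if a = j then c + (k - 1) else c - 1) T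

theorem primrec_purse {α : Type*} [Primcodable α] (k j : ℕ) {T : α → ℕ} {l : α → List ℕ}
    (hT : Primrec T) (hl : Primrec l) : Primrec fun a => purse k j (T a) (l a) := by
  unfold purse
  refine Primrec.list_foldl (h := fun _ p => if p.1 = 0 then 0 else if p.2 = j then p.1 + (k - 1)
    else p.1 - 1) hl hT ?_
  have h1 : Primrec fun p : α × (ℕ × ℕ) => p.2.1 := Primrec.fst.comp Primrec.snd
  have h2 : Primrec fun p : α × (ℕ × ℕ) => p.2.2 := Primrec.snd.comp Primrec.snd
  exact Primrec.ite (Primrec.eq.comp h1 (Primrec.const 0)) (Primrec.const 0)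
    (Primrec.ite (Primrec.eq.comp h2 (Primrec.const j))
      (Primrec.nat_add.comp h1 (Primrec.const _)) (Primrec.nat_sub.comp h1 (Primrec.const 1)))

theorem purse_zero (k j : ℕ) (l : List ℕ) : purse k j 0 l = 0 := by
  induction l with
  | nil => rfl
  | cons a l ih => exact ih

theorem purse_cons {k j T : ℕ} (hT : T ≠ 0) (a : ℕ) (l : List ℕ) :
    purse k j T (a :: l) = purse k j (if a = j then T + (k - 1) else T - 1) l := by
  simp [purse, hT]

theorem winners_cons {k n : ℕ} (a : Fin k) (x : Fin n → Fin k) :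
    winners (Fin.cons a x : Fin (n + 1) → Fin k) = (a : ℕ) :: winners x := by
  simp [winners, List.ofFn_succ]

theorem wins_zero {k n : ℕ} (x : Fin n → Fin k) (j : Fin k) : wins x 0 j = 0 := by
  simp [wins]

theorem wins_cons_succ {k n : ℕ} (a : Fin k) (x : Fin n → Fin k) (m : ℕ) (j : Fin k) :
    wins (Fin.cons a x : Fin (n + 1) → Fin k) (m + 1) j = (if a = j then 1 else 0) + wins x m j := by
  simp only [wins, Finset.card_filter, Fin.sum_univ_succ, Fin.cons_zero, Fin.cons_succ,
    Fin.val_zero, Fin.val_succ, Nat.succ_pos, true_and, Nat.add_lt_add_iff_right]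

/-- The purse is empty at the end exactly when the unrestricted capital was `0` or less after some
round. -/
theorem purse_eq_zero_iff {k n : ℕ} (x : Fin n → Fin k) (j : Fin k) (T : ℕ) :
    purse k j T (winners x) = 0 ↔ ∃ m ≤ n, T + k * wins x m j ≤ m := by
  induction n generalizing T with
  | zero =>
    simp [winners, purse, wins_zero]
  | succ n ih =>
    obtain ⟨a, y, rfl⟩ : ∃ a y, x = (Fin.cons a y : Fin (n + 1) → Fin k) :=
      ⟨x 0, Fin.tail x, (Fin.cons_self_tail x).symm⟩
    by_cases hT : T = 0
    · subst hT
      simp only [purse_zero, true_iff]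
      exact ⟨0, Nat.zero_le _, by simp [wins_zero]⟩
    rw [winners_cons, purse_cons hT, ih]
    have hk : 0 < k := a.pos
    have key : ∀ m, (if (a : ℕ) = j then T + (k - 1) else T - 1) + k * wins y m j ≤ m ↔
        T + k * wins (Fin.cons a y : Fin (n + 1) → Fin k) (m + 1) j ≤ m + 1 := by
      intro m
      rw [wins_cons_succ, mul_add]
      by_cases haj : a = j
      · subst haj
        simp only [if_true, mul_one]
        omega
      · have : (a : ℕ) ≠ j := fun h => haj (Fin.ext h)
        simp only [haj, this, if_false, mul_zero]
        omega
    simp only [key]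
    constructor
    · rintro ⟨m, hm, h⟩
      exact ⟨m + 1, by omega, h⟩
    · rintro ⟨m, hm, h⟩
      cases m with
      | zero => omega
      | succ m => exact ⟨m, by omega, h⟩

/-- Counting by the winner of the first round. -/
theorem card_filter_cons {k n : ℕ} (P : (Fin (n + 1) → Fin k) → Prop) [DecidablePred P] :
    (Finset.univ.filter P).card =
      ∑ a : Fin k, (Finset.univ.filter fun x : Fin n → Fin k => P (Fin.cons a x)).card := by
  simp only [Finset.card_filter]
  rw [← (Fin.consEquiv fun _ : Fin (n + 1) => Fin k).sum_comp, Fintype.sum_prod_type]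
  rfl

/-! ### Large losses are rare -/

theorem exp_le_one_add_add_sq {u : ℝ} (hu : u ≤ 1) : Real.exp u ≤ 1 + u + u ^ 2 := by
  rcases le_or_gt (-1) u with h | h
  · have := Real.abs_exp_sub_one_sub_id_le (abs_le.2 ⟨h, hu⟩)
    have := (abs_le.1 this).2
    linarith
  · have : Real.exp u ≤ 1 := Real.exp_le_one_iff.2 (by linarith)
    nlinarith

theorem sum_ite_eq_fin {k : ℕ} (j : Fin k) (p q : ℝ) :
    ∑ a : Fin k, (if (a : ℕ) = j then p else q) = p + ((k : ℝ) - 1) * q := by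
  have h : ∀ a : Fin k, (if (a : ℕ) = j then p else q) = q + if a = j then p - q else 0 := by
    intro a
    by_cases haj : a = j
    · simp [haj]
    · have : (a : ℕ) ≠ j := fun h => haj (Fin.ext h)
      simp [haj, this]
  simp only [h, Finset.sum_add_distrib, Finset.sum_const, Finset.card_univ, Fintype.card_fin,
    nsmul_eq_mul, Finset.sum_ite_eq', Finset.mem_univ, if_true]
  ring

theorem cast_purse_step {k T : ℕ} (hk : 0 < k) (hT : T ≠ 0) (a j : ℕ) :
    (((if a = j then T + (k - 1) else T - 1 : ℕ) : ℕ) : ℝ) =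
      T + (if a = j then (k : ℝ) - 1 else -1) := by
  split_ifs
  · rw [Nat.cast_add, Nat.cast_sub hk, Nat.cast_one]
  · rw [Nat.cast_sub (by omega), Nat.cast_one, sub_eq_add_neg]

theorem card_purse_eq_zero_le {k : ℕ} (j : Fin k) {u : ℝ} (hu0 : 0 ≤ u) (hu1 : u ≤ 1) (n T : ℕ) :
    ((Finset.univ.filter fun x : Fin n → Fin k => purse k j T (winners x) = 0).card : ℝ) ≤
      (k : ℝ) ^ n * Real.exp (n * (u ^ 2 * k) - u * T) := by
  have hk : 0 < k := j.pos
  have hk1 : (1 : ℝ) ≤ k := by exact_mod_cast hk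
  induction n generalizing T with
  | zero =>
    by_cases hT : T = 0
    · simp [hT, purse_zero]
    · simp only [winners, List.ofFn_zero, purse, List.foldl_nil, hT, Finset.filter_false,
        Finset.card_empty, Nat.cast_zero]
      positivity
  | succ n ih =>
    by_cases hT : T = 0
    · have h1 : (1 : ℝ) ≤ Real.exp ((n + 1 : ℕ) * (u ^ 2 * k) - u * T) := by
        rw [Real.one_le_exp_iff, hT]
        simp only [Nat.cast_zero, mul_zero, sub_zero]
        positivity
      have h2 : ((Finset.univ.filter fun x : Fin (n + 1) → Fin k =>
          purse k j T (winners x) = 0).card : ℝ) ≤ (k : ℝ) ^ (n + 1) := by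
        have := Finset.card_filter_le (Finset.univ : Finset (Fin (n + 1) → Fin k))
          fun x => purse k j T (winners x) = 0
        rw [Finset.card_univ, Fintype.card_fun, Fintype.card_fin, Fintype.card_fin] at this
        exact_mod_cast this
      exact h2.trans (le_mul_of_one_le_right (by positivity) h1)
    · rw [card_filter_cons]
      simp only [winners_cons, purse_cons hT]
      push_cast
      have hexp : ∀ a : Fin k, Real.exp (n * (u ^ 2 * k) -
          u * ((if (a : ℕ) = j then T + (k - 1) else T - 1 : ℕ) : ℕ)) =
          Real.exp (n * (u ^ 2 * k) - u * T) *
            (if (a : ℕ) = j then Real.exp (-(u * ((k : ℝ) - 1))) else Real.exp u) := by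
        intro a
        rw [cast_purse_step hk hT]
        split_ifs <;> rw [← Real.exp_add] <;> congr 1 <;> ring
      have hone : Real.exp (-(u * ((k : ℝ) - 1))) + ((k : ℝ) - 1) * Real.exp u ≤
          k * Real.exp (u ^ 2 * k) := by
        have h1 : Real.exp (-(u * ((k : ℝ) - 1))) ≤
            1 + -(u * ((k : ℝ) - 1)) + (-(u * ((k : ℝ) - 1))) ^ 2 :=
          exp_le_one_add_add_sq (by nlinarith)
        have h2 := exp_le_one_add_add_sq hu1
        have h3 := Real.add_one_le_exp (u ^ 2 * (k : ℝ))
        have h4 : ((k : ℝ) - 1) * Real.exp u ≤ ((k : ℝ) - 1) * (1 + u + u ^ 2) :=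
          mul_le_mul_of_nonneg_left h2 (by linarith)
        have h5 : (k : ℝ) * (u ^ 2 * k + 1) ≤ k * Real.exp (u ^ 2 * k) :=
          mul_le_mul_of_nonneg_left h3 (by linarith)
        nlinarith [sq_nonneg u, mul_nonneg (sq_nonneg u) (by linarith : (0 : ℝ) ≤ k)]
      calc ∑ a : Fin k, ((Finset.univ.filter fun x : Fin n → Fin k =>
            purse k j (if (a : ℕ) = j then T + (k - 1) else T - 1) (winners x) = 0).card : ℝ)
          ≤ ∑ a : Fin k, (k : ℝ) ^ n * (Real.exp (n * (u ^ 2 * k) - u * T) *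
            (if (a : ℕ) = j then Real.exp (-(u * ((k : ℝ) - 1))) else Real.exp u)) := by
            refine Finset.sum_le_sum fun a _ => ?_
            rw [← hexp]
            exact ih _
        _ = (k : ℝ) ^ n * (Real.exp (n * (u ^ 2 * k) - u * T) *
            (Real.exp (-(u * ((k : ℝ) - 1))) + ((k : ℝ) - 1) * Real.exp u)) := by
            rw [← Finset.mul_sum, ← Finset.mul_sum, sum_ite_eq_fin]
        _ ≤ (k : ℝ) ^ n * (Real.exp (n * (u ^ 2 * k) - u * T) * (k * Real.exp (u ^ 2 * k))) := by
            gcongr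
        _ = (k : ℝ) ^ (n + 1) * (Real.exp (n * (u ^ 2 * k) - u * T) * Real.exp (u ^ 2 * k)) := by
            ring
        _ = _ := by
            rw [← Real.exp_add]
            congr 2
            ring

/-! ### Two players rarely both survive -/

/-- The probability that neither of the players `i` and `j`, who start with `A` and `B`, is ruined in
`n` rounds. -/
noncomputable def survival (k : ℕ) (i j : Fin k) (n A B : ℕ) : ℝ :=
  ((Finset.univ.filter fun x : Fin n → Fin k =>
    purse k i A (winners x) ≠ 0 ∧ purse k j B (winners x) ≠ 0).card : ℝ) / (k : ℝ) ^ n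

section Survival

variable {k : ℕ} {i j : Fin k}

theorem survival_eq_zero {A B : ℕ} (h : A = 0 ∨ B = 0) (n : ℕ) : survival k i j n A B = 0 := by
  rcases h with rfl | rfl <;> simp [survival, purse_zero]

theorem survival_zero_le (A B : ℕ) : survival k i j 0 A B ≤ 1 := by
  unfold survival
  rw [pow_zero, div_one]
  have := Finset.card_filter_le (Finset.univ : Finset (Fin 0 → Fin k))
    fun x => purse k i A (winners x) ≠ 0 ∧ purse k j B (winners x) ≠ 0
  rw [Finset.card_univ, Fintype.card_fun, Fintype.card_fin, Fintype.card_fin, pow_zero] at this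
  exact_mod_cast this

theorem survival_zero {A B : ℕ} (hA : A ≠ 0) (hB : B ≠ 0) : survival k i j 0 A B = 1 := by
  simp [survival, winners, purse, hA, hB]

theorem survival_succ {A B : ℕ} (hA : A ≠ 0) (hB : B ≠ 0) (n : ℕ) :
    survival k i j (n + 1) A B = (∑ a : Fin k, survival k i j n
      (if (a : ℕ) = i then A + (k - 1) else A - 1)
      (if (a : ℕ) = j then B + (k - 1) else B - 1)) / k := by
  unfold survival
  rw [card_filter_cons]
  simp only [winners_cons, purse_cons hA, purse_cons hB]
  rw [← Finset.sum_div, div_div, pow_succ]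
  push_cast
  rfl

theorem survival_antitone (n A B : ℕ) : survival k i j (n + 1) A B ≤ survival k i j n A B := by
  have hk : (0 : ℝ) < k := by exact_mod_cast i.pos
  induction n generalizing A B with
  | zero =>
    by_cases h : A = 0 ∨ B = 0
    · rw [survival_eq_zero h, survival_eq_zero h]
    · push Not at h
      rw [survival_succ h.1 h.2, survival_zero h.1 h.2, div_le_one hk]
      calc _ ≤ ∑ a : Fin k, (1 : ℝ) := Finset.sum_le_sum fun a _ => survival_zero_le _ _
        _ = k := by simp
  | succ n ih =>
    by_cases h : A = 0 ∨ B = 0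
    · rw [survival_eq_zero h, survival_eq_zero h]
    · push Not at h
      rw [survival_succ h.1 h.2 (n + 1), survival_succ h.1 h.2 n]
      gcongr
      exact ih _ _

theorem sum_purse_step_mul (hij : i ≠ j) {A B : ℕ} (hA : A ≠ 0) (hB : B ≠ 0) :
    ∑ a : Fin k, ((((if (a : ℕ) = i then A + (k - 1) else A - 1 : ℕ) : ℕ) : ℝ) *
      (((if (a : ℕ) = j then B + (k - 1) else B - 1 : ℕ) : ℕ) : ℝ)) = k * (A * B - 1) := by
  have hk : 0 < k := i.pos
  have hval : (i : ℕ) ≠ j := fun h => hij (Fin.ext h)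
  have h : ∀ a : Fin k, ((((if (a : ℕ) = i then A + (k - 1) else A - 1 : ℕ) : ℕ) : ℝ) *
      (((if (a : ℕ) = j then B + (k - 1) else B - 1 : ℕ) : ℕ) : ℝ)) =
      (if (a : ℕ) = i then (k : ℝ) * (B - 1) else 0) +
      (if (a : ℕ) = j then (k : ℝ) * (A - 1) else 0) + ((A : ℝ) - 1) * (B - 1) := by
    intro a
    rw [cast_purse_step hk hA, cast_purse_step hk hB]
    split_ifs with h1 h2 h2
    · exact absurd (h1.symm.trans h2) hval
    all_goals ring
  simp only [h, Finset.sum_add_distrib, sum_ite_eq_fin, Finset.sum_const, Finset.card_univ,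
    Fintype.card_fin, nsmul_eq_mul]
  ring

/-- The expected time (cut off at `n`) until one of two players is ruined is at most the product
of their initial capitals. -/
theorem sum_survival_le (hij : i ≠ j) (n A B : ℕ) :
    ∑ m ∈ Finset.range n, survival k i j m A B ≤ A * B := by
  have hk : (0 : ℝ) < k := by exact_mod_cast i.pos
  induction n generalizing A B with
  | zero => simp only [Finset.range_zero, Finset.sum_empty]; positivity
  | succ n ih =>
    by_cases h : A = 0 ∨ B = 0
    · rw [Finset.sum_eq_zero fun m _ => survival_eq_zero h m]
      positivity
    · push Not at h
      rw [Finset.sum_range_succ', survival_zero h.1 h.2]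
      simp only [survival_succ h.1 h.2]
      rw [← Finset.sum_div, Finset.sum_comm]
      have h1 : ∑ a : Fin k, ∑ m ∈ Finset.range n, survival k i j m
          (if (a : ℕ) = i then A + (k - 1) else A - 1)
          (if (a : ℕ) = j then B + (k - 1) else B - 1) ≤ k * (A * B - 1) := by
        rw [← sum_purse_step_mul hij h.1 h.2]
        exact Finset.sum_le_sum fun a _ => ih _ _
      have h2 := div_le_div_of_nonneg_right h1 hk.le
      rw [mul_div_cancel_left₀ _ hk.ne'] at h2
      linarith

theorem mul_survival_le (hij : i ≠ j) (n A B : ℕ) : n * survival k i j n A B ≤ A * B := by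
  refine le_trans ?_ (sum_survival_le hij n A B)
  have hanti : Antitone fun m => survival k i j m A B :=
    antitone_nat_of_succ_le fun m => survival_antitone m A B
  calc n * survival k i j n A B = ∑ m ∈ Finset.range n, survival k i j n A B := by simp
    _ ≤ _ := Finset.sum_le_sum fun m hm => hanti (Finset.mem_range.1 hm).le

end Survival

/-! ### Atypical outcomes are compressible -/

theorem condComplexity_code_le_of_card_le {k n : ℕ} (hk : 0 < k) {c s : ℝ} {y : ℕ}
    {x : Fin n → Fin k} {P : (Fin n → Fin k) → Prop} [DecidablePred P] (hx : P x)
    (h : (condComplexity (code x) y : ℝ) ≤ c + s + Real.logb 2 ({x | P x}.ncard : ℝ)) {b : ℝ}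
    (hb : 0 < b) (hcard : ((Finset.univ.filter P).card : ℝ) ≤ (k : ℝ) ^ n * b) :
    (condComplexity (code x) y : ℝ) ≤ c + s + n * Real.logb 2 k + Real.logb 2 b := by
  have hset : {x | P x} = ((Finset.univ.filter P : Finset (Fin n → Fin k)) : Set _) := by simp
  rw [hset, Set.ncard_coe_finset] at h
  have hk' : (0 : ℝ) < k := by exact_mod_cast hk
  have hpos : 0 < (Finset.univ.filter P).card :=
    Finset.card_pos.2 ⟨x, Finset.mem_filter.2 ⟨Finset.mem_univ _, hx⟩⟩
  have h1 : Real.logb 2 ((Finset.univ.filter P).card : ℝ) ≤ Real.logb 2 ((k : ℝ) ^ n * b) :=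
    Real.logb_le_logb_of_le (by norm_num) (by exact_mod_cast hpos) hcard
  rw [Real.logb_mul (by positivity) hb.ne', Real.logb_pow] at h1
  linarith

/-- An outcome in which some player loses `2 ^ s` units within the first `n` rounds is
compressible. -/
theorem exists_condComplexity_le_of_loss (k : ℕ) : ∃ c : ℕ, ∀ (n s m : ℕ) (x : Fin n → Fin k)
    (j : Fin k), m ≤ n → 2 ^ s + k * wins x m j ≤ m →
      (condComplexity (code x) (Nat.pair k n) : ℝ) ≤
        c + s + n * Real.logb 2 k - ((2 : ℝ) ^ s) ^ 2 / (4 * n * k) := by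
  have hG : ∀ j : Fin k, PrimrecPred fun t : (ℕ × ℕ) × List ℕ =>
      purse k j (2 ^ t.1.1) t.2 = 0 := by
    intro j
    exact Primrec.eq.comp (primrec_purse k j
      (primrec_pow.comp (Primrec.const 2) (Primrec.fst.comp Primrec.fst)) Primrec.snd)
      (Primrec.const 0)
  choose c hc using fun j : Fin k => condComplexity_code_le k
    (ν := fun y => y.unpair.2) (G := fun s _ l => purse k j (2 ^ s) l = 0)
    (Primrec.snd.comp Primrec.unpair) (hG j)
  refine ⟨Finset.univ.sup c, fun n s m x j hm hloss => ?_⟩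
  have hk : 0 < k := j.pos
  have hx : purse k j (2 ^ s) (winners x) = 0 := (purse_eq_zero_iff x j _).2 ⟨m, hm, hloss⟩
  have h2s : 0 < 2 ^ s := by positivity
  have hsn : 2 ^ s ≤ n := by omega
  have hn : 0 < n := by omega
  have hk1 : (1 : ℝ) ≤ k := by exact_mod_cast hk
  have hn1 : (1 : ℝ) ≤ n := by exact_mod_cast hn
  have hsn' : (2 : ℝ) ^ s ≤ n := by exact_mod_cast hsn
  have hu1 : (2 : ℝ) ^ s / (2 * n * k) ≤ 1 := by
    rw [div_le_one (by positivity)]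
    nlinarith
  have hcard := card_purse_eq_zero_le j (u := (2 : ℝ) ^ s / (2 * n * k)) (by positivity) hu1 n (2 ^ s)
  have h := condComplexity_code_le_of_card_le (P := fun x => purse k j (2 ^ s) (winners x) = 0)
    hk hx (hc j s (Nat.pair k n) n (by simp) x hx) (Real.exp_pos _) hcard
  have hcj : (c j : ℝ) ≤ (Finset.univ.sup c : ℕ) := by
    exact_mod_cast Finset.le_sup (Finset.mem_univ j)
  have hE : (n : ℝ) * (((2 : ℝ) ^ s / (2 * n * k)) ^ 2 * k) -
      (2 : ℝ) ^ s / (2 * n * k) * ((2 ^ s : ℕ) : ℝ) = -(((2 : ℝ) ^ s) ^ 2 / (4 * n * k)) := by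
    push_cast
    field_simp
    ring
  rw [hE] at h
  have hlog : Real.logb 2 (Real.exp (-(((2 : ℝ) ^ s) ^ 2 / (4 * n * k)))) ≤
      -(((2 : ℝ) ^ s) ^ 2 / (4 * n * k)) := by
    rw [Real.logb, Real.log_exp, div_le_iff₀ (Real.log_pos (by norm_num))]
    have h1 : Real.log 2 ≤ 1 := by linarith [Real.log_two_lt_d9]
    have h2 : 0 ≤ ((2 : ℝ) ^ s) ^ 2 / (4 * n * k) := by positivity
    nlinarith
  linarith

/-- An outcome in which two players with initial capital about `√n / 8 ^ s` survive `n` rounds is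
compressible. -/
theorem exists_condComplexity_le_of_survival (k : ℕ) : ∃ c : ℕ, ∀ (n s : ℕ) (x : Fin n → Fin k)
    (i j : Fin k), 0 < n → i ≠ j → purse k i (n / 64 ^ s).sqrt (winners x) ≠ 0 →
      purse k j (n / 64 ^ s).sqrt (winners x) ≠ 0 →
      (condComplexity (code x) (Nat.pair n k) : ℝ) ≤ c + n * Real.logb 2 k - 5 * s := by
  have hT : Primrec fun t : (ℕ × ℕ) × List ℕ => (t.1.2.unpair.1 / 64 ^ t.1.1).sqrt :=
    Primrec.nat_sqrt.comp (Primrec.nat_div.comp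
      (Primrec.fst.comp (Primrec.unpair.comp (Primrec.snd.comp Primrec.fst)))
      (primrec_pow.comp (Primrec.const 64) (Primrec.fst.comp Primrec.fst)))
  have hG : ∀ p : Fin k × Fin k, PrimrecPred fun t : (ℕ × ℕ) × List ℕ =>
      purse k p.1 (t.1.2.unpair.1 / 64 ^ t.1.1).sqrt t.2 ≠ 0 ∧
        purse k p.2 (t.1.2.unpair.1 / 64 ^ t.1.1).sqrt t.2 ≠ 0 := by
    intro p
    exact PrimrecPred.and
      (PrimrecPred.not (Primrec.eq.comp (primrec_purse k p.1 hT Primrec.snd) (Primrec.const 0)))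
      (PrimrecPred.not (Primrec.eq.comp (primrec_purse k p.2 hT Primrec.snd) (Primrec.const 0)))
  choose c hc using fun p => condComplexity_code_le k
    (ν := fun y => y.unpair.1) (G := fun s y l => purse k p.1 (y.unpair.1 / 64 ^ s).sqrt l ≠ 0 ∧
      purse k p.2 (y.unpair.1 / 64 ^ s).sqrt l ≠ 0) (Primrec.fst.comp Primrec.unpair) (hG p)
  refine ⟨Finset.univ.sup c, fun n s x i j hn hij hi hj => ?_⟩
  have hk : 0 < k := i.pos
  have hk' : (0 : ℝ) < k := by exact_mod_cast hk
  have hn' : (0 : ℝ) < n := by exact_mod_cast hn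
  set T := (n / 64 ^ s).sqrt with hTdef
  have hx : purse k i ((Nat.pair n k).unpair.1 / 64 ^ s).sqrt (winners x) ≠ 0 ∧
      purse k j ((Nat.pair n k).unpair.1 / 64 ^ s).sqrt (winners x) ≠ 0 := by
    simpa only [Nat.unpair_pair] using And.intro hi hj
  have h := hc (i, j) s (Nat.pair n k) n (by simp) x hx
  simp only [Nat.unpair_pair, ← hTdef] at h
  have hT2 : (T : ℝ) * T * 64 ^ s ≤ n := by
    have h1 : T * T ≤ n / 64 ^ s := Nat.sqrt_le _
    have h2 : T * T * 64 ^ s ≤ n := (Nat.le_div_iff_mul_le (by positivity)).1 h1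
    exact_mod_cast h2
  have hcard : ((Finset.univ.filter fun x : Fin n → Fin k =>
      purse k i T (winners x) ≠ 0 ∧ purse k j T (winners x) ≠ 0).card : ℝ) ≤
      (k : ℝ) ^ n * ((64 : ℝ) ^ s)⁻¹ := by
    have h1 := mul_survival_le hij n T T
    have h2 : survival k i j n T T ≤ ((64 : ℝ) ^ s)⁻¹ := by
      rw [← one_div, le_div_iff₀ (by positivity)]
      refine le_of_mul_le_mul_left (a := (n : ℝ)) ?_ hn'
      calc (n : ℝ) * (survival k i j n T T * 64 ^ s) = n * survival k i j n T T * 64 ^ s := by ring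
        _ ≤ T * T * 64 ^ s := by gcongr
        _ ≤ n * 1 := by rwa [mul_one]
    unfold survival at h2
    rwa [div_le_iff₀' (by positivity)] at h2
  have h := condComplexity_code_le_of_card_le (P := fun x : Fin n → Fin k =>
    purse k i T (winners x) ≠ 0 ∧ purse k j T (winners x) ≠ 0) hk ⟨hi, hj⟩ h (by positivity) hcard
  have hcj : (c (i, j) : ℝ) ≤ (Finset.univ.sup c : ℕ) := by
    exact_mod_cast Finset.le_sup (Finset.mem_univ (i, j))
  have h64 : Real.logb 2 ((64 : ℝ) ^ s)⁻¹ = -(6 * s) := by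
    rw [Real.logb_inv, Real.logb_pow, show (64 : ℝ) = 2 ^ (6 : ℕ) by norm_num, Real.logb_pow,
      Real.logb_self_eq_one (by norm_num)]
    push_cast
    ring
  linarith

/-! ### Monopolists -/

theorem sum_wins {k n : ℕ} (x : Fin n → Fin k) : ∑ i, wins x n i = n := by
  have h : ∀ i, wins x n i = (Finset.univ.filter fun t => x t = i).card := by
    intro i
    simp [wins]
  simp only [h]
  rw [← Finset.card_eq_sum_card_fiberwise (f := x) (t := Finset.univ) (by simp)]
  simp

theorem sum_capital {k n : ℕ} (hk : k ≠ 0) (I : ℝ) (x : Fin n → Fin k) :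
    ∑ i, capital I x n i = I := by
  have h1 : ∑ i, (wins x n i : ℝ) = n := by exact_mod_cast sum_wins x
  have h2 : ∀ i, capital I x n i = (I / k - n) + k * (wins x n i : ℝ) := by
    intro i
    unfold capital
    ring
  have hk' : (k : ℝ) ≠ 0 := by exact_mod_cast hk
  simp only [h2, Finset.sum_add_distrib, ← Finset.mul_sum, h1, Finset.sum_const, Finset.card_univ,
    Fintype.card_fin, nsmul_eq_mul]
  field_simp
  ring

/-- Without a monopolist at the end, at least two players have survived. -/
theorem exists_ne_not_hasLostAll {k n : ℕ} (hk : k ≠ 0) {I : ℝ} (hI : 0 < I) {x : Fin n → Fin k}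
    (h : ¬ ∃ i, IsMonopolist I x n i) :
    ∃ i j, i ≠ j ∧ ¬ HasLostAll I x n i ∧ ¬ HasLostAll I x n j := by
  have key : ∀ i, 0 < capital I x n i → ∃ j, j ≠ i ∧ ¬ HasLostAll I x n j := by
    intro i hi
    by_contra! hcon
    exact h ⟨i, hi, hcon⟩
  obtain ⟨i₀, hi₀⟩ : ∃ i, 0 < capital I x n i := by
    by_contra! hcon
    have := Finset.sum_nonpos fun i (_ : i ∈ Finset.univ) => hcon i
    rw [sum_capital hk] at this
    linarith
  obtain ⟨j, -, hj⟩ := key i₀ hi₀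
  have hjpos : 0 < capital I x n j := by
    by_contra! hcon
    exact hj ⟨n, le_rfl, hcon⟩
  obtain ⟨i, hij, hi⟩ := key j hjpos
  exact ⟨i, j, hij, hi, hj⟩

theorem purse_ne_zero_of_not_hasLostAll {k n : ℕ} {I : ℝ} {x : Fin n → Fin k} {j : Fin k} {T : ℕ}
    (h : ¬ HasLostAll I x n j) (hT : I / k ≤ T) : purse k j T (winners x) ≠ 0 := by
  intro h0
  obtain ⟨m, hm, hle⟩ := (purse_eq_zero_iff x j T).1 h0
  refine h ⟨m, hm, ?_⟩
  have : (T : ℝ) + k * wins x m j ≤ m := by exact_mod_cast hle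
  unfold capital
  linarith

open Filter Asymptotics

/-! ### Growth -/

theorem eventually_log_lt_rpow (c : ℝ) {a b : ℝ} (ha : 0 < a) (hb : 0 < b) :
    ∀ᶠ n : ℕ in atTop, c + Real.logb 2 n < b * (n : ℝ) ^ a := by
  have h1 : (fun x : ℝ => c + Real.logb 2 x) =o[atTop] fun x => x ^ a := by
    refine IsLittleO.add ?_ ?_
    · exact isLittleO_const_left.2 (Or.inr (tendsto_norm_atTop_atTop.comp (tendsto_rpow_atTop ha)))
    · refine ((isLittleO_log_rpow_atTop ha).const_mul_left (Real.log 2)⁻¹).congr_left fun x => ?_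
      rw [Real.logb, div_eq_inv_mul]
  have h2 := (h1.comp_tendsto tendsto_natCast_atTop_atTop).bound (half_pos hb)
  filter_upwards [h2, eventually_ge_atTop 1] with n hn hn1
  have hpos : 0 < (n : ℝ) ^ a := Real.rpow_pos_of_pos (by exact_mod_cast hn1) a
  simp only [Function.comp, Real.norm_eq_abs, abs_of_pos hpos] at hn
  nlinarith [le_abs_self (c + Real.logb 2 (n : ℝ))]

theorem eventually_le_rpow (c : ℝ) {a : ℝ} (ha : 0 < a) : ∀ᶠ n : ℕ in atTop, c ≤ (n : ℝ) ^ a :=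
  ((tendsto_rpow_atTop ha).comp tendsto_natCast_atTop_atTop).eventually_ge_atTop c

theorem eventually_lt_mul_logb (c : ℝ) {a : ℝ} (ha : 0 < a) :
    ∀ᶠ n : ℕ in atTop, c < a * Real.logb 2 n :=
  (((Real.tendsto_logb_atTop (by norm_num)).comp tendsto_natCast_atTop_atTop).const_mul_atTop
    ha).eventually_gt_atTop c

/-! ### No monopolist -/

theorem eventually_not_isMonopolist {k : ℕ} (hk : 2 ≤ k) {ε : ℝ} (hε : 0 < ε) :
    ∀ᶠ n : ℕ in atTop, ∀ x : Fin n → Fin k,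
      (n : ℝ) * Real.logb 2 k - 1 / (32 * k ^ 3) * (n : ℝ) ^ (2 * ε)
          ≤ (condComplexity (code x) (Nat.pair k n) : ℝ) →
      ∀ I : ℝ, 0 < I → (n : ℝ) < I ^ (2 / (1 + 2 * ε)) →
        ∀ m : ℕ, m ≤ n → ¬ ∃ i : Fin k, IsMonopolist I x m i := by
  obtain ⟨c, hc⟩ := exists_condComplexity_le_of_loss k
  have hkpos : (0 : ℝ) < k := by exact_mod_cast (by omega : 0 < k)
  filter_upwards [eventually_log_lt_rpow c (a := 2 * ε) (b := 1 / (32 * (k : ℝ) ^ 3))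
      (by positivity) (by positivity),
    eventually_le_rpow (k : ℝ) (a := (1 + 2 * ε) / 2) (by positivity),
    eventually_ge_atTop 1] with n hlog hge hn1 x hx I hI hnI m hm ⟨i, hi⟩
  have hnpos : (0 : ℝ) < n := by exact_mod_cast hn1
  have : Nontrivial (Fin k) := Fin.nontrivial_iff_two_le.2 hk
  obtain ⟨j, hj⟩ := exists_ne i
  obtain ⟨m', hm', hcap⟩ := hi.2 j hj
  have hrI : (n : ℝ) ^ ((1 + 2 * ε) / 2) < I := by
    have h := Real.rpow_lt_rpow hnpos.le hnI (z := (1 + 2 * ε) / 2) (by positivity)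
    rw [← Real.rpow_mul hI.le] at h
    have he : 2 / (1 + 2 * ε) * ((1 + 2 * ε) / 2) = 1 := by field_simp
    rwa [he, Real.rpow_one] at h
  obtain ⟨s, hs1, hs2⟩ := exists_nat_pow_near (x := (n : ℝ) ^ ((1 + 2 * ε) / 2) / k) (y := 2)
    ((one_le_div hkpos).2 hge) (by norm_num)
  have hloss : 2 ^ s + k * wins x m' j ≤ m' := by
    have h1 : (2 : ℝ) ^ s ≤ I / k := hs1.trans (by gcongr)
    unfold capital at hcap
    have h2 : (2 : ℝ) ^ s + k * wins x m' j ≤ m' := by linarith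
    exact_mod_cast h2
  have hC := hc n s m' x j (hm'.trans hm) hloss
  have hs : (s : ℝ) ≤ Real.logb 2 n := by
    rw [Real.le_logb_iff_rpow_le (by norm_num) hnpos, Real.rpow_natCast]
    have : 2 ^ s ≤ n := by omega
    exact_mod_cast this
  have hpow : 1 / (16 * (k : ℝ) ^ 3) * (n : ℝ) ^ (2 * ε) ≤ ((2 : ℝ) ^ s) ^ 2 / (4 * n * k) := by
    have h1 : (n : ℝ) ^ ((1 + 2 * ε) / 2) ≤ 2 * k * 2 ^ s := by
      rw [div_lt_iff₀ hkpos, pow_succ] at hs2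
      linarith
    have h2 : ((n : ℝ) ^ ((1 + 2 * ε) / 2)) ^ 2 = n * (n : ℝ) ^ (2 * ε) := by
      rw [← Real.rpow_natCast, ← Real.rpow_mul hnpos.le]
      push_cast
      rw [div_mul_cancel₀ _ (by norm_num), Real.rpow_add hnpos, Real.rpow_one]
    have h3 : n * (n : ℝ) ^ (2 * ε) ≤ (2 * k * 2 ^ s) ^ 2 := by
      rw [← h2]
      gcongr
    rw [le_div_iff₀ (by positivity)]
    calc 1 / (16 * (k : ℝ) ^ 3) * (n : ℝ) ^ (2 * ε) * (4 * n * k)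
        = (n * (n : ℝ) ^ (2 * ε)) * (1 / (4 * (k : ℝ) ^ 2)) := by field_simp; norm_num
      _ ≤ (2 * k * 2 ^ s) ^ 2 * (1 / (4 * (k : ℝ) ^ 2)) := by gcongr
      _ = ((2 : ℝ) ^ s) ^ 2 := by field_simp; norm_num
  have hhalf : 1 / (16 * (k : ℝ) ^ 3) * (n : ℝ) ^ (2 * ε) =
      2 * (1 / (32 * (k : ℝ) ^ 3) * (n : ℝ) ^ (2 * ε)) := by field_simp; norm_num
  linarith

/-! ### A monopolist -/

theorem eventually_exists_isMonopolist {k : ℕ} (hk : 3 ≤ k) {ε : ℝ} (hε : 0 < ε) (hε' : ε < 1 / 4) :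
    ∀ᶠ n : ℕ in atTop, ∀ x : Fin n → Fin k,
      (n : ℝ) * Real.logb 2 k - ε * Real.logb 2 n
          ≤ (condComplexity (code x) (Nat.pair n k) : ℝ) →
      ∀ I : ℝ, 0 < I → n = ⌊(I / ((k : ℝ) - 2)) ^ (2 / (1 - 2 * ε))⌋₊ →
        ∃ m : ℕ, (m : ℝ) ≤ (I / ((k : ℝ) - 2)) ^ (2 / (1 - 2 * ε)) ∧
          ∃ i : Fin k, IsMonopolist I x m i := by
  obtain ⟨c, hc⟩ := exists_condComplexity_le_of_survival k
  have hk3 : (3 : ℝ) ≤ k := by exact_mod_cast hk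
  have he : 0 < 1 - 2 * ε := by linarith
  filter_upwards [eventually_lt_mul_logb ((c : ℝ) + 50 / 6) (a := 2 / 3 * ε) (by positivity),
    eventually_le_rpow 16 (a := 2 * ε) (by positivity),
    eventually_ge_atTop 1] with n hlog hge hn1 x hx I hI hnI
  have hnpos : (0 : ℝ) < n := by exact_mod_cast hn1
  have hn1' : (1 : ℝ) ≤ n := by exact_mod_cast hn1
  have hbase : 0 < I / ((k : ℝ) - 2) := div_pos hI (by linarith)
  refine ⟨n, by
    nth_rewrite 1 [hnI]
    exact Nat.floor_le (by positivity), ?_⟩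
  by_contra hcon
  obtain ⟨i, j, hij, hi, hj⟩ := exists_ne_not_hasLostAll (by omega) hI hcon
  set r := (n : ℝ) ^ ((1 - 2 * ε) / 2) with hr
  have hr1 : 1 ≤ r := Real.one_le_rpow hn1' (by positivity)
  have hIr : I / k ≤ 2 * r := by
    have h1 : (I / ((k : ℝ) - 2)) ^ (2 / (1 - 2 * ε)) < 2 * n := by
      have := Nat.lt_floor_add_one ((I / ((k : ℝ) - 2)) ^ (2 / (1 - 2 * ε)))
      rw [← hnI] at this
      linarith
    have h2 := Real.rpow_lt_rpow (by positivity) h1 (z := (1 - 2 * ε) / 2) (by positivity)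
    have he1 : 2 / (1 - 2 * ε) * ((1 - 2 * ε) / 2) = 1 := by field_simp
    rw [← Real.rpow_mul hbase.le, he1, Real.rpow_one, Real.mul_rpow (by norm_num) hnpos.le] at h2
    have h3 : (2 : ℝ) ^ ((1 - 2 * ε) / 2) ≤ 2 ^ (1 : ℝ) :=
      Real.rpow_le_rpow_of_exponent_le (by norm_num) (by linarith)
    rw [Real.rpow_one] at h3
    have h4 : I / k ≤ I / ((k : ℝ) - 2) :=
      div_le_div_of_nonneg_left hI.le (by linarith) (by linarith)
    nlinarith
  obtain ⟨s, hs1, hs2⟩ := exists_nat_pow_near (x := (n : ℝ) ^ (2 * ε) / 16) (y := 64)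
    ((one_le_div (by norm_num)).2 hge) (by norm_num)
  have hT : I / k ≤ ((n / 64 ^ s).sqrt : ℕ) := by
    refine hIr.trans ((Nat.le_ceil _).trans ?_)
    have h1 : (⌈2 * r⌉₊ : ℝ) ≤ 4 * r := by
      have := Nat.ceil_lt_add_one (a := 2 * r) (by positivity)
      linarith
    have h2 : r ^ 2 * (n : ℝ) ^ (2 * ε) = n := by
      rw [hr, ← Real.rpow_natCast, ← Real.rpow_mul hnpos.le, ← Real.rpow_add hnpos]
      push_cast
      rw [show (1 - 2 * ε) / 2 * 2 + 2 * ε = 1 by ring, Real.rpow_one]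
    have h3 : (⌈2 * r⌉₊ : ℝ) ^ 2 * 64 ^ s ≤ n := by
      calc (⌈2 * r⌉₊ : ℝ) ^ 2 * 64 ^ s ≤ (4 * r) ^ 2 * ((n : ℝ) ^ (2 * ε) / 16) := by gcongr
        _ = r ^ 2 * (n : ℝ) ^ (2 * ε) := by ring
        _ = n := h2
    have h4 : ⌈2 * r⌉₊ ^ 2 * 64 ^ s ≤ n := by exact_mod_cast h3
    have h5 : ⌈2 * r⌉₊ ≤ (n / 64 ^ s).sqrt :=
      Nat.le_sqrt'.2 ((Nat.le_div_iff_mul_le (by positivity)).2 h4)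
    exact_mod_cast h5
  have hC := hc n s x i j (by omega) hij (purse_ne_zero_of_not_hasLostAll hi hT)
    (purse_ne_zero_of_not_hasLostAll hj hT)
  have hs : 2 * ε * Real.logb 2 n - 4 < 6 * (s + 1) := by
    have h1 := Real.logb_lt_logb (b := 2) (by norm_num) (by positivity) hs2
    have hlog16 : Real.logb 2 16 = 4 := by
      rw [show (16 : ℝ) = 2 ^ (4 : ℕ) by norm_num, Real.logb_pow, Real.logb_self_eq_one (by norm_num)]
      norm_num
    have hlog64 : Real.logb 2 64 = 6 := by
      rw [show (64 : ℝ) = 2 ^ (6 : ℕ) by norm_num, Real.logb_pow, Real.logb_self_eq_one (by norm_num)]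
      norm_num
    rw [Real.logb_div (by positivity) (by norm_num), Real.logb_rpow_eq_mul_logb_of_pos hnpos,
      Real.logb_pow, hlog16, hlog64] at h1
    push_cast at h1
    linarith
  linarith

end MonopolistGame

theorem mainTheorem6 :
    -- Part (i)
    (∀ k : ℕ, 2 ≤ k → ∃ δ : ℝ, 0 < δ ∧ ∀ ε : ℝ, 0 < ε → ∃ N : ℕ, ∀ n : ℕ, N ≤ n →
      (∀ x : Fin n → Fin k,
        (n : ℝ) * Real.logb 2 k - δ * (n : ℝ) ^ (2 * ε) * Real.logb 2 k
            ≤ (MonopolistGame.condComplexity (MonopolistGame.code x) (Nat.pair k n) : ℝ) →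
        ∀ I : ℝ, 0 < I → (n : ℝ) < I ^ (2 / (1 + 2 * ε)) →
          ∀ m : ℕ, m ≤ n → ¬ ∃ i : Fin k, MonopolistGame.IsMonopolist I x m i) ∧
      1 - 1 / (2 : ℝ) ^ (δ * (n : ℝ) ^ (2 * ε) * Real.logb 2 k)
        ≤ MonopolistGame.prob {x : Fin n → Fin k |
            (n : ℝ) * Real.logb 2 k - δ * (n : ℝ) ^ (2 * ε) * Real.logb 2 k
              ≤ (MonopolistGame.condComplexity (MonopolistGame.code x) (Nat.pair k n) : ℝ)} ∧
      (∀ I : ℝ, 0 < I → (n : ℝ) < I ^ (2 / (1 + 2 * ε)) →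
        1 - 1 / (2 : ℝ) ^ (δ * (n : ℝ) ^ (2 * ε) * Real.logb 2 k)
          ≤ MonopolistGame.prob {x : Fin n → Fin k |
              ∀ m : ℕ, m ≤ n → ¬ ∃ i : Fin k, MonopolistGame.IsMonopolist I x m i})) ∧
    -- Part (ii)
    (∀ k : ℕ, 3 ≤ k → ∀ ε : ℝ, 0 < ε → ε < 1 / 4 → ∃ N : ℕ, ∀ n : ℕ, N ≤ n →
      (∀ x : Fin n → Fin k,
        (n : ℝ) * Real.logb 2 k - ε * Real.logb 2 n
            ≤ (MonopolistGame.condComplexity (MonopolistGame.code x) (Nat.pair n k) : ℝ) →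
        ∀ I : ℝ, 0 < I → n = ⌊(I / ((k : ℝ) - 2)) ^ (2 / (1 - 2 * ε))⌋₊ →
          ∃ m : ℕ, (m : ℝ) ≤ (I / ((k : ℝ) - 2)) ^ (2 / (1 - 2 * ε)) ∧
            ∃ i : Fin k, MonopolistGame.IsMonopolist I x m i) ∧
      1 - 1 / (n : ℝ) ^ ε
        ≤ MonopolistGame.prob {x : Fin n → Fin k |
            (n : ℝ) * Real.logb 2 k - ε * Real.logb 2 n
              ≤ (MonopolistGame.condComplexity (MonopolistGame.code x) (Nat.pair n k) : ℝ)} ∧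
      (∀ I : ℝ, 0 < I → n = ⌊(I / ((k : ℝ) - 2)) ^ (2 / (1 - 2 * ε))⌋₊ →
        1 - 1 / (n : ℝ) ^ ε
          ≤ MonopolistGame.prob {x : Fin n → Fin k |
              ∃ m : ℕ, (m : ℝ) ≤ (I / ((k : ℝ) - 2)) ^ (2 / (1 - 2 * ε)) ∧
                ∃ i : Fin k, MonopolistGame.IsMonopolist I x m i})) := by
  refine ⟨fun k hk => ?_, fun k hk ε hε hε' => ?_⟩
  · have hlogk : 0 < Real.logb 2 k := Real.logb_pos (by norm_num) (by exact_mod_cast hk)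
    have hkpos : (0 : ℝ) < k := by exact_mod_cast (by omega : 0 < k)
    refine ⟨1 / (32 * k ^ 3) / Real.logb 2 k, by positivity, fun ε hε => ?_⟩
    obtain ⟨N, hN⟩ := Filter.eventually_atTop.1
      ((MonopolistGame.eventually_not_isMonopolist hk hε).and (Filter.eventually_ge_atTop 1))
    refine ⟨N, fun n hn => ?_⟩
    obtain ⟨h, hn1⟩ := hN n hn
    have hd : 1 / (32 * (k : ℝ) ^ 3) / Real.logb 2 k * (n : ℝ) ^ (2 * ε) * Real.logb 2 k =
        1 / (32 * (k : ℝ) ^ 3) * (n : ℝ) ^ (2 * ε) := by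
      field_simp
    rw [hd]
    have hp := MonopolistGame.one_sub_le_prob_condComplexity (k := k) (n := n) (by omega) (by omega)
      (Nat.pair k n) (1 / (32 * (k : ℝ) ^ 3) * (n : ℝ) ^ (2 * ε))
    exact ⟨h, hp, fun I hI hnI => hp.trans (MonopolistGame.prob_mono fun x hx => h x hx I hI hnI)⟩
  · obtain ⟨N, hN⟩ := Filter.eventually_atTop.1
      ((MonopolistGame.eventually_exists_isMonopolist hk hε hε').and (Filter.eventually_ge_atTop 1))
    refine ⟨N, fun n hn => ?_⟩
    obtain ⟨h, hn1⟩ := hN n hn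
    have hp := MonopolistGame.one_sub_le_prob_condComplexity (k := k) (n := n) (by omega) (by omega)
      (Nat.pair n k) (ε * Real.logb 2 n)
    have hd : (2 : ℝ) ^ (ε * Real.logb 2 n) = (n : ℝ) ^ ε := by
      rw [mul_comm, Real.rpow_mul (by norm_num),
        Real.rpow_logb (by norm_num) (by norm_num) (by exact_mod_cast hn1)]
    rw [hd] at hp
    exact ⟨h, hp, fun I hI hnI => hp.trans (MonopolistGame.prob_mono fun x hx => h x hx I hI hnI)⟩
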